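/- Let $k$ be a field and let $A=\bigoplus_{i\ge 0}A_i$ be a normal graded $k$-algebra, i.e. a finitely generated graded $k$-algebra that is an integral domain, with $A_0=k$, and integrally closed in its field of fractions. Let $G$ be a finite group of $k$-algebra automorphisms of $A$ (that is, a finite group acting faithfully on $A$ by $k$-algebra automorphisms; they need not preserve the grading), let $M$ be a finite dimensional representation of $G$ over $k$, and let $G$ act diagonally on $A\otimes_k M$. For a subgroup $H\le G$ write $A^H$ for the ring of $H$-invariants and $(A\otimes_k M)^H$ for the $A^H$-module of $H$-invariants of $A\otimes_kM$, and regard $\operatorname{Hom}_{A^H}(A,(A\otimes_k M)^H)$ as an $A$-module by $(a\varphi)(b)=\varphi(ab)$. For subgroups $H\le K\le G$ let $\operatorname{Tr}^K_H:(A\otimes_kM)^H\to(A\otimes_kM)^K$, $u\mapsto\sum_{\sigma H\in K/H}\sigma(u)$, let $$\Phi^K_H:\operatorname{Hom}_{A^H}(A,(A\otimes_kM)^H)\to\operatorname{Hom}_{A^K}(A,(A\otimes_kM)^K),\qquad \varphi\mapsto \operatorname{Tr}^K_H\circ\varphi,$$ which is a homomorphism of $A$-modules, and let $C^K_H$ be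 its cokernel. For a prime ideal $P\subset A$ put $H_i(P)=\{\sigma\in H:\ \sigma(a)-a\in P\text{ for all }a\in A\}$ (the inertia subgroup), in particular $G_i(P)$ for $H=G$. Let $W\le G$ be the subgroup generated by the reflections, i.e. by all $\sigma\in G$ that lie in $G_i(P)$ for some prime ideal $P$ of height one. A homomorphism of $A$-modules is an isomorphism at $P$ if its localization at $P$ is an isomorphism, and is generically an isomorphism if it is an isomorphism at the prime ideal $(0)$. \textbf{Theorem.} Let $H\le G$ be a subgroup. (i) The $A$-modules $\operatorname{Hom}_{A^H}(A,(A\otimes_kM)^H)$ and $\operatorname{Hom}_{A^G}(A,(A\otimes_kM)^G)$ are finitely generated and reflexive. The map $\Phi^G_H$ is injective and generically an isomorphism, and it is an isomorphism at every prime ideal $P\subset A$ of height one with $G_i(P)=H_i(P)$. (ii) For every subgroup $K\le G$ with $K\supseteq W$, the map $\Phi^G_K$ is an isomorphism. (iii) Let $P$ be a prime ideal of $A$ of height one, and put $G_i=G_i(P)$, $H_i=H_i(P)$. Then $$(C^G_H)_P\simeq (C^{G_i}_{H_i})_P$$ as $A_P$-modules, and in particular $$\operatorname{length}_{A_P}\big((C^G_H)_P\big)=\operatorname{length}_{A_P}\big((C^{G_i}_{H_i})_P\big).$$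 -/

import Mathlib

open scoped TensorProduct

namespace Covariants

section Action

variable {k G A M : Type*} [Field k] [Group G] [CommRing A] [Algebra k A]
  [MulSemiringAction G A] [SMulCommClass G k A]
  [AddCommGroup M] [Module k M] (ρ : Representation k G M)

/-- The diagonal action of `G` on `A ⊗ M`: `σ (a ⊗ m) = σ a ⊗ σ m`. -/
noncomputable def diagAction : Representation k G (A ⊗[k] M) :=
  (Representation.ofDistribMulAction k G A).tprod ρ

@[simp]
theorem diagAction_tmul (g : G) (a : A) (m : M) :
    diagAction (A := A) ρ g (a ⊗ₜ[k] m) = (g • a) ⊗ₜ[k] (ρ g m) := rfl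

theorem diagAction_smul (g : G) (a : A) (w : A ⊗[k] M) :
    diagAction ρ g (a • w) = (g • a) • diagAction ρ g w := by
  induction w with
  | zero => simp
  | tmul b m => simp [TensorProduct.smul_tmul']
  | add x y hx hy => simp only [smul_add, map_add, hx, hy]

variable (k A) in
/-- The ring of invariants `A^H` of a subgroup `H` of `G`, as a `k`-subalgebra of `A`. -/
abbrev invariantRing (H : Subgroup G) : Subalgebra k A :=
  FixedPoints.subalgebra k A H

theorem mem_invariantRing {H : Subgroup G} {a : A} :
    a ∈ invariantRing k A H ↔ ∀ h ∈ H, h • a = a :=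
  ⟨fun ha h hh => ha ⟨h, hh⟩, fun ha h => ha h.1 h.2⟩

theorem invariantRing_anti {H K : Subgroup G} (hHK : H ≤ K) :
    invariantRing k A K ≤ invariantRing k A H :=
  fun _ ha => mem_invariantRing.2 fun h hh => mem_invariantRing.1 ha h (hHK hh)

variable (A) in
/-- The module of covariants `A^H(M) = (A ⊗ M)^H`, as an `A^H`-submodule of `A ⊗ M`. -/
noncomputable def covariants (H : Subgroup G) :
    Submodule (invariantRing k A H) (A ⊗[k] M) where
  carrier := {w | ∀ h ∈ H, diagAction ρ h w = w}
  add_mem' hx hy h hh := by rw [map_add, hx h hh, hy h hh]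
  zero_mem' h _ := map_zero _
  smul_mem' c w hw h hh := by
    change diagAction ρ h ((c : A) • w) = (c : A) • w
    rw [diagAction_smul, hw h hh, mem_invariantRing.1 c.2 h hh]

theorem mem_covariants {H : Subgroup G} {w : A ⊗[k] M} :
    w ∈ covariants A ρ H ↔ ∀ h ∈ H, diagAction ρ h w = w := Iff.rfl

variable (A) in
/-- `Hom_{A^H}(A, (A ⊗ M)^H)`. -/
def HomCov (H : Subgroup G) : Type _ :=
  A →ₗ[invariantRing k A H] covariants A ρ H

noncomputable instance homCovAddCommGroup (H : Subgroup G) : AddCommGroup (HomCov A ρ H) :=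
  LinearMap.addCommGroup (R₁ := invariantRing k A H) (R₂ := invariantRing k A H) (M := A) (N₂ := covariants A ρ H)
    (σ₁₂ := RingHom.id _)

instance homCovFunLike (H : Subgroup G) : FunLike (HomCov A ρ H) A (covariants A ρ H) :=
  inferInstanceAs (FunLike (A →ₗ[invariantRing k A H] covariants A ρ H) A (covariants A ρ H))

instance homCovLinearMapClass (H : Subgroup G) :
    LinearMapClass (HomCov A ρ H) (invariantRing k A H) A (covariants A ρ H) :=
  inferInstanceAs (LinearMapClass (A →ₗ[invariantRing k A H] covariants A ρ H)
    (invariantRing k A H) A (covariants A ρ H))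

/-- An element of `HomCov`, as an `A^H`-linear map. -/
def HomCov.toLinearMap {ρ : Representation k G M} {H : Subgroup G} (φ : HomCov A ρ H) :
    A →ₗ[invariantRing k A H] covariants A ρ H := φ

/-- An `A^H`-linear map `A → (A ⊗ M)^H`, as an element of `HomCov`. -/
def HomCov.ofLinearMap {ρ : Representation k G M} {H : Subgroup G}
    (f : A →ₗ[invariantRing k A H] covariants A ρ H) : HomCov A ρ H := f

/-- The `A`-module structure on `Hom_{A^H}(A, (A ⊗ M)^H)` coming from the source:
`(a • φ) b = φ (a * b)`. -/
noncomputable instance homCovModule (H : Subgroup G) : Module A (HomCov A ρ H) where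
  smul a φ := HomCov.ofLinearMap (φ.toLinearMap ∘ₗ LinearMap.mulLeft (invariantRing k A H) a)
  one_smul φ := DFunLike.ext _ _ fun b => congrArg φ (one_mul b)
  mul_smul a b φ := DFunLike.ext _ _ fun c => congrArg φ
    (show a * b * c = b * (a * c) by ring)
  smul_zero a := DFunLike.ext _ _ fun b => rfl
  smul_add a φ ψ := DFunLike.ext _ _ fun b => rfl
  add_smul a b φ := DFunLike.ext _ _ fun c =>
    (congrArg φ (add_mul a b c)).trans (map_add φ _ _)
  zero_smul φ := DFunLike.ext _ _ fun c => (congrArg φ (zero_mul c)).trans (map_zero φ)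

theorem homCov_smul_apply (H : Subgroup G) (a : A) (φ : HomCov A ρ H) (b : A) :
    (a • φ) b = φ (a * b) := rfl

/-- For `w ∈ (A ⊗ M)^H`, the element `σ w` for a coset `σ H ∈ K / H`. -/
noncomputable def cosetAction {H K : Subgroup G} (w : covariants A ρ H) :
    K ⧸ H.subgroupOf K → A ⊗[k] M :=
  Quotient.lift (fun σ : K => diagAction ρ (σ : G) (w : A ⊗[k] M)) (by
    intro σ τ h
    have h' : (σ : G)⁻¹ * τ ∈ H := by
      simpa [Subgroup.mem_subgroupOf] using QuotientGroup.leftRel_apply.1 h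
    have := w.2 _ h'
    change diagAction ρ (σ : G) (w : A ⊗[k] M) = diagAction ρ (τ : G) (w : A ⊗[k] M)
    conv_lhs => rw [← this, ← Module.End.mul_apply, ← map_mul, mul_inv_cancel_left])

theorem cosetAction_mk {H K : Subgroup G} (w : covariants A ρ H) (σ : K) :
    cosetAction ρ w (QuotientGroup.mk σ : K ⧸ H.subgroupOf K)
      = diagAction ρ (σ : G) (w : A ⊗[k] M) := rfl

theorem cosetAction_smul {H K : Subgroup G} (w : covariants A ρ H) (σ : K)
    (q : K ⧸ H.subgroupOf K) :
    diagAction ρ (σ : G) (cosetAction ρ w q) = cosetAction ρ w (σ • q) := by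
  induction q using QuotientGroup.induction_on with
  | H τ =>
    rw [cosetAction_mk, ← Module.End.mul_apply, ← map_mul]
    rfl

variable [Finite G]

variable (A) in
/-- The relative transfer `Tr^K_H : (A ⊗ M)^H → (A ⊗ M)^K`,
`w ↦ ∑_{σ H ∈ K / H} σ w`, for subgroups `H ≤ K`. -/
noncomputable def transfer (H K : Subgroup G) :
    covariants A ρ H →+ covariants A ρ K where
  toFun w := ⟨∑ᶠ q : K ⧸ H.subgroupOf K, cosetAction ρ w q, fun h hh => by
    rw [map_finsum _ (Set.toFinite _)]
    exact (finsum_congr fun q => cosetAction_smul ρ w ⟨h, hh⟩ q).trans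
      (finsum_comp_equiv (MulAction.toPerm (⟨h, hh⟩ : K)))⟩
  map_zero' := by
    refine Subtype.ext ((finsum_congr fun q => ?_).trans finsum_zero)
    induction q using QuotientGroup.induction_on with
    | H τ => rw [cosetAction_mk]; exact map_zero _
  map_add' w v := by
    refine Subtype.ext (Eq.trans (finsum_congr fun q => ?_)
      (finsum_add_distrib (Set.toFinite _) (Set.toFinite _)))
    induction q using QuotientGroup.induction_on with
    | H τ => simp only [cosetAction_mk]; exact map_add _ _ _

theorem transfer_coe (H K : Subgroup G) (w : covariants A ρ H) :
    (transfer A ρ H K w : A ⊗[k] M) = ∑ᶠ q : K ⧸ H.subgroupOf K, cosetAction ρ w q := rfl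

theorem transfer_smul {H K : Subgroup G} (hHK : H ≤ K) (c : invariantRing k A K)
    (w : covariants A ρ H) :
    transfer A ρ H K ((⟨c, invariantRing_anti hHK c.2⟩ : invariantRing k A H) • w)
      = c • transfer A ρ H K w := by
  refine Subtype.ext ?_
  change _ = (c : A) • (transfer A ρ H K w : A ⊗[k] M)
  rw [transfer_coe, transfer_coe, smul_finsum' _ (Set.toFinite _)]
  refine finsum_congr fun q => ?_
  induction q using QuotientGroup.induction_on with
  | H τ =>
    rw [cosetAction_mk, cosetAction_mk]
    change diagAction ρ (τ : G) ((c : A) • (w : A ⊗[k] M)) = _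
    rw [diagAction_smul, mem_invariantRing.1 c.2 τ τ.2]

variable (A) in
/-- For subgroups `H ≤ K` the `A`-module homomorphism
`Φ^K_H : Hom_{A^H}(A, (A ⊗ M)^H) → Hom_{A^K}(A, (A ⊗ M)^K)`, `φ ↦ Tr^K_H ∘ φ`. -/
noncomputable def Phi {H K : Subgroup G} (hHK : H ≤ K) :
    HomCov A ρ H →ₗ[A] HomCov A ρ K where
  toFun φ := HomCov.ofLinearMap
    { toFun := fun a => transfer A ρ H K (φ a)
      map_add' := fun a b => by rw [map_add, map_add]
      map_smul' := fun c a => by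
        have h : φ (c • a) =
            (⟨c, invariantRing_anti hHK c.2⟩ : invariantRing k A H) • φ a :=
          map_smul φ (⟨c, invariantRing_anti hHK c.2⟩ : invariantRing k A H) a
        rw [h, transfer_smul ρ hHK]
        rfl }
  map_add' φ ψ := DFunLike.ext _ _ fun a => map_add (transfer A ρ H K) (φ a) (ψ a)
  map_smul' a φ := DFunLike.ext _ _ fun b => rfl

theorem Phi_apply {H K : Subgroup G} (hHK : H ≤ K) (φ : HomCov A ρ H) (a : A) :
    Phi A ρ hHK φ a = transfer A ρ H K (φ a) := rfl

variable (A) in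
/-- The cokernel `C^K_H` of `Φ^K_H`. -/
abbrev Coker {H K : Subgroup G} (hHK : H ≤ K) : Type _ :=
  HomCov A ρ K ⧸ LinearMap.range (Phi A ρ hHK)

end Action

section Ramification

variable {G A : Type*} [Group G] [CommRing A] [MulSemiringAction G A]

/-- The inertia subgroup `H_i(P) = {σ ∈ H | ∀ a, σ a - a ∈ P}` of a subgroup `H` of `G`,
as a subgroup of `G`. -/
def inertiaIn (H : Subgroup G) (P : Ideal A) : Subgroup G :=
  H ⊓ P.inertia G

theorem mem_inertiaIn {H : Subgroup G} {P : Ideal A} {σ : G} :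
    σ ∈ inertiaIn H P ↔ σ ∈ H ∧ ∀ a : A, σ • a - a ∈ P := Iff.rfl

theorem inertiaIn_mono {H K : Subgroup G} (hHK : H ≤ K) (P : Ideal A) :
    inertiaIn H P ≤ inertiaIn K P :=
  inf_le_inf_right _ hHK

variable (G A) in
/-- The reflection subgroup `W` of `G` acting on `A`: it is generated by the elements that lie in
the inertia subgroup of some prime ideal of height one. -/
def reflectionSubgroup : Subgroup G :=
  Subgroup.closure {σ | ∃ P : Ideal A, P.IsPrime ∧ P.height = 1 ∧ σ ∈ inertiaIn ⊤ P}

end Ramification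

/-- An `A`-linear map is an isomorphism at the prime ideal `P` if its localization at `P` is
bijective. -/
def IsIsoAt {A N N' : Type*} [CommRing A] [AddCommMonoid N] [Module A N]
    [AddCommMonoid N'] [Module A N'] (P : Ideal A) [P.IsPrime] (f : N →ₗ[A] N') : Prop :=
  Function.Bijective (LocalizedModule.map P.primeCompl f)

end Covariants

namespace Covariants

/-! ### Noetherian normal domains: height-one primes and reflexivity -/

section CommutativeAlgebra

variable {A : Type*} [CommRing A]

/-! Everything is moved into the free module `A ⊗ M`. For a suitable nonzero `G`-invariant `s`, each
`φ` in `HomCov A ρ H` has a unique `w` with `Tr_H(b w) = s φ(b)` for all `b`, because the trace form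
is nondegenerate. The elements obtained form `traceDual A ρ s H`, written `D_H`: those `w` for which
`s` divides every `Tr_H(b w)`. Transitivity of the trace turns `Φ^K_H` into the inclusion of `D_H`
in `D_K` (`exists_embedding`), so injectivity and functoriality are clear and `C^K_H` becomes `D_K /
D_H`.

Two facts then suffice. At any prime `P`, `D_K` and `D_I` have the same localization, where `I` is
the inertia group of `P` in `K` (`exists_smul_mem_traceDual_inertiaIn`): the elements of `K` outside
`I` can be separated from `I` by functions that do not vanish at `P`. This gives the local
isomorphisms and (iii). Secondly, `A` being normal, divisibility by `s` is decided at the primes of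
height one, hence so is membership in `D_H` (`mem_traceDual_of_forall_height_eq_one`). This gives
reflexivity, and (ii), since `W` contains all inertia groups of height-one primes. -/

theorem dvd_of_forall_mul_eq [IsDomain A] [IsNoetherianRing A] [IsIntegrallyClosed A]
    {P : Ideal A} {s y : A} (hs : s ≠ 0) (hsP : s ∈ P) (h : ∀ p ∈ P, ∃ t ∈ P, p * y = s * t) :
    s ∣ y := by
  have hsK : algebraMap A (FractionRing A) s ≠ 0 := by simpa using hs
  have hint : IsIntegral A
      (algebraMap A (FractionRing A) y / algebraMap A (FractionRing A) s) := by
    -- Determinant trick: `y / s` stabilizes the nonzero finitely generated module `P` inside the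
    -- fraction field.
    refine isIntegral_of_smul_mem_submodule
      (Submodule.map (Algebra.linearMap A (FractionRing A)) P) ?_
      ((IsNoetherian.noetherian P).map _) _ ?_
    · exact (Submodule.ne_bot_iff _).2 ⟨_, ⟨s, hsP, rfl⟩, hsK⟩
    · rintro _ ⟨p, hp, rfl⟩
      obtain ⟨t, htP, ht⟩ := h p hp
      refine ⟨t, htP, ?_⟩
      have := congrArg (algebraMap A (FractionRing A)) ht
      simp only [map_mul] at this
      simp only [Algebra.linearMap_apply, smul_eq_mul]
      field_simp
      linear_combination -this
  obtain ⟨r, hr⟩ := IsIntegrallyClosed.algebraMap_eq_of_integral hint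
  refine ⟨r, FaithfulSMul.algebraMap_injective A (FractionRing A) ?_⟩
  rw [map_mul, hr, mul_div_cancel₀ _ hsK]

/-- In a Noetherian normal domain, divisibility by a nonzero element can be checked locally at the
prime ideals of height one. -/
theorem dvd_of_forall_height_eq_one [IsDomain A] [IsNoetherianRing A] [IsIntegrallyClosed A]
    {s y : A} (hs : s ≠ 0)
    (h : ∀ P : Ideal A, P.IsPrime → P.height = 1 → ∃ t ∉ P, s ∣ t * y) : s ∣ y := by
  by_contra hy
  have hx : (Ideal.Quotient.mk (Ideal.span {s}) y : A ⧸ Ideal.span {s}) ≠ 0 := by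
    rwa [Ne, Ideal.Quotient.eq_zero_iff_dvd]
  obtain ⟨P, hPass, hle⟩ := exists_le_isAssociatedPrime_of_isNoetherianRing A _ hx
  obtain ⟨hP, z, hz⟩ := isAssociatedPrime_iff.1 hPass
  obtain ⟨y', rfl⟩ := Ideal.Quotient.mk_surjective z
  have hmem : ∀ p, p ∈ P ↔ s ∣ p * y' := fun p => by
    rw [hz, Submodule.mem_colon_singleton, Submodule.mem_bot, ← Ideal.Quotient.eq_zero_iff_dvd,
      map_mul]
    rfl
  have hyP : ∀ t, s ∣ t * y → t ∈ P := fun t ht => hle <| by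
    rw [Submodule.mem_colon_singleton, Submodule.mem_bot]
    have := (Ideal.Quotient.eq_zero_iff_dvd s (t * y)).2 ht
    rwa [map_mul] at this
  have hsP : s ∈ P := (hmem s).2 (dvd_mul_right _ _)
  have hy' : ¬ s ∣ y' := fun hd => hP.ne_top ((Ideal.eq_top_iff_one _).2 ((hmem 1).2 (by simpa)))
  obtain ⟨p, hp, t, ht, htP⟩ : ∃ p ∈ P, ∃ t, p * y' = s * t ∧ t ∉ P := by
    by_contra! hcon
    refine hy' (dvd_of_forall_mul_eq hs hsP fun p hp => ?_)
    obtain ⟨t, ht⟩ := (hmem p).1 hp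
    exact ⟨t, hcon p hp t ht, ht⟩
  -- As `p y' = s t` with `t ∉ P`, every `q ∈ P` satisfies `q t ∈ (p)`. So `p` generates `P`
  -- locally, and Krull's principal ideal theorem bounds the height.
  have hmin : P ∈ (Ideal.span {p}).minimalPrimes := by
    refine ⟨⟨hP, by simpa [Ideal.span_le] using hp⟩, fun Q ⟨hQ, hpQ⟩ hQP q hq => ?_⟩
    obtain ⟨r, hr⟩ := (hmem q).1 hq
    have : q * t = r * p := mul_left_cancel₀ hs (by linear_combination (-q) * ht + p * hr)
    have hm : q * t ∈ Q := this ▸ Q.mul_mem_left r (hpQ (Ideal.mem_span_singleton_self p))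
    exact (hQ.mem_or_mem hm).resolve_right fun h => htP (hQP h)
  have h1 : P.height = 1 := le_antisymm
    (Ideal.height_le_one_of_isPrincipal_of_mem_minimalPrimes _ P hmin)
    (Order.one_le_iff_ne_zero.2 fun h0 => by
      rw [Ideal.height_eq_zero_iff_eq_bot] at h0
      rw [h0] at hsP
      exact hs hsP)
  obtain ⟨t, htP, htd⟩ := h P hP h1
  exact htP (hyP t htd)

theorem exists_smul_eq_of_forall_height_eq_one [IsDomain A] [IsNoetherianRing A]
    [IsIntegrallyClosed A] {F : Type*} [AddCommGroup F] [Module A F] [Module.Free A F]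
    [Module.Finite A F] {s : A} (hs : s ≠ 0) {y : F}
    (h : ∀ P : Ideal A, P.IsPrime → P.height = 1 → ∃ t ∉ P, ∃ v : F, t • y = s • v) :
    ∃ v : F, y = s • v := by
  let b := Module.Free.chooseBasis A F
  have key : ∀ i, s ∣ b.repr y i := fun i => dvd_of_forall_height_eq_one hs fun P hP h1 => by
    obtain ⟨t, ht, v, hv⟩ := h P hP h1
    refine ⟨t, ht, b.repr v i, ?_⟩
    simpa using congrArg (fun w => b.repr w i) hv
  choose c hc using key
  refine ⟨∑ i, c i • b i, b.ext_elem fun i => ?_⟩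
  rw [map_smul, Finsupp.smul_apply, b.repr_sum_self, smul_eq_mul, hc]

theorem isPrincipalIdealRing_of_height_eq_one [IsDomain A] [IsNoetherianRing A]
    [IsIntegrallyClosed A] (P : Ideal A) [P.IsPrime] (hP : P.height = 1) :
    IsPrincipalIdealRing (Localization.AtPrime P) := by
  have : IsDomain (Localization.AtPrime P) :=
    IsLocalization.isDomain_localization P.primeCompl_le_nonZeroDivisors
  have : IsNoetherianRing (Localization.AtPrime P) :=
    IsLocalization.isNoetherianRing P.primeCompl _ inferInstance
  have : IsIntegrallyClosed (Localization.AtPrime P) :=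
    isIntegrallyClosed_of_isLocalization _ P.primeCompl P.primeCompl_le_nonZeroDivisors
  have hdim : Ring.KrullDimLE 1 (Localization.AtPrime P) := by
    rw [Ring.krullDimLE_iff, IsLocalization.AtPrime.ringKrullDim_eq_height P, hP]
    rfl
  have h := (tfae_of_isNoetherianRing_of_isLocalRing_of_isDomain (Localization.AtPrime P)).out 0 3
  exact h.2 ⟨inferInstance, fun Q hQ hQ' => IsLocalRing.eq_maximalIdeal
    ((Ring.krullDimLE_one_iff_of_isPrime_bot.1 hdim) Q hQ hQ')⟩

/-- A submodule of a finite free module over a Noetherian normal domain that contains a nonzero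
multiple of the free module and is determined by its localizations at the prime ideals of height
one is reflexive. -/
theorem isReflexive_of_forall_height_eq_one [IsDomain A] [IsNoetherianRing A]
    [IsIntegrallyClosed A] {F : Type*} [AddCommGroup F] [Module A F] [Module.Free A F]
    [Module.Finite A F] (N : Submodule A F) {s : A} (hs : s ≠ 0) (hsN : ∀ x : F, s • x ∈ N)
    (hN : ∀ u : F, (∀ P : Ideal A, P.IsPrime → P.height = 1 → ∃ t ∉ P, t • u ∈ N) → u ∈ N) :
    Module.IsReflexive A N := by
  let m : F →ₗ[A] N := (LinearMap.lsmul A F s).codRestrict N hsN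
  have hm : ∀ g : Module.Dual A N, N.subtype.dualMap (g ∘ₗ m) = s • g := fun g =>
    LinearMap.ext fun n => by
      have : m n = s • n := rfl
      change g (m n) = s • g n
      rw [this, map_smul]
  refine ⟨fun x y hxy => ?_, fun θ => ?_⟩
  · refine Subtype.ext ((Module.evalEquiv A F).injective (LinearMap.ext fun f => ?_))
    exact LinearMap.congr_fun hxy (N.subtype.dualMap f)
  -- `θ` restricted to functionals that extend to `F` is evaluation at some `u`, as `F` is
  -- reflexive. Since `s • g` always extends, `u` determines `θ`; what remains is `u ∈ N`.
  · let u : F := (Module.evalEquiv A F).symm (θ ∘ₗ N.subtype.dualMap)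
    have hu : ∀ f : Module.Dual A F, f u = θ (N.subtype.dualMap f) := fun f => by
      have : Module.evalEquiv A F u = θ ∘ₗ N.subtype.dualMap :=
        (Module.evalEquiv A F).apply_symm_apply _
      exact LinearMap.congr_fun this f
    have hsu : ∀ g : Module.Dual A N, g (m u) = s * θ g := fun g => by
      rw [← smul_eq_mul, ← map_smul, ← hm, ← hu]
      rfl
    have huN : u ∈ N := by
      refine hN u fun P hP h1 => ?_
      have := isPrincipalIdealRing_of_height_eq_one P h1
      have : IsDomain (Localization.AtPrime P) :=
        IsLocalization.isDomain_localization P.primeCompl_le_nonZeroDivisors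
      have : Module.FinitePresentation A N := Module.finitePresentation_of_finite A N
      let b := Module.Free.chooseBasis (Localization.AtPrime P) (LocalizedModule P.primeCompl N)
      let ι := LocalizedModule.mkLinearMap P.primeCompl N
      -- Over the principal ideal domain `A_P` the localization of `N` is free. Up to a denominator
      -- each coordinate comes from a functional `g` on `N`, and `g (s u) = s * θ g`; so `s u` lies
      -- in `s N_P`.
      have key : ∀ i, ∃ c : Localization.AtPrime P, b.repr (ι (m u)) i = s • c := fun i => by
        obtain ⟨g, t, hg⟩ := Module.FinitePresentation.exists_lift_of_isLocalizedModule
          P.primeCompl (Algebra.linearMap A (Localization.AtPrime P))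
          ((b.coord i).restrictScalars A ∘ₗ ι)
        have h2 : algebraMap A (Localization.AtPrime P) (g (m u)) = t • b.repr (ι (m u)) i :=
          LinearMap.congr_fun hg (m u)
        obtain ⟨t', ht'⟩ := (IsLocalization.map_units (Localization.AtPrime P) t).exists_left_inv
        refine ⟨t' * algebraMap _ _ (θ g), ?_⟩
        rw [hsu, map_mul, Submonoid.smul_def, Algebra.smul_def] at h2
        rw [Algebra.smul_def]
        linear_combination (-b.repr (ι (m u)) i) * ht' - t' * h2
      choose c hc using key
      have hv : ι (m u) = s • ∑ i, c i • b i := b.ext_elem fun i => by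
        rw [hc, Finset.smul_sum]
        simp_rw [← smul_assoc]
        rw [b.repr_sum_self]
      obtain ⟨⟨n, t⟩, hn⟩ := IsLocalizedModule.mk'_surjective P.primeCompl ι (∑ i, c i • b i)
      refine ⟨t, t.2, ?_⟩
      have h3 : ι ((t : A) • m u) = ι (s • n) := by
        rw [map_smul, hv, map_smul, ← hn, Function.uncurry_apply_pair, smul_comm]
        congr 1
        exact IsLocalizedModule.mk'_cancel' ι n t
      obtain ⟨c', hc'⟩ := (IsLocalizedModule.eq_iff_exists P.primeCompl ι).1 h3
      have h4 : (c' : A) • (t : A) • s • u = (c' : A) • s • (n : F) := congrArg Subtype.val hc'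
      have hc0 : (c' : A) ≠ 0 := fun h0 => c'.2 (h0 ▸ P.zero_mem)
      rw [smul_comm (t : A) s] at h4
      rw [smul_right_injective F hs (smul_right_injective F hc0 h4)]
      exact n.2
    refine ⟨⟨u, huN⟩, LinearMap.ext fun g => mul_left_cancel₀ hs ?_⟩
    rw [← hsu, ← smul_eq_mul]
    change s • g ⟨u, huN⟩ = _
    rw [← map_smul]
    rfl

theorem localizedModule_map_bijective (S : Submonoid A) {N N' : Type*} [AddCommGroup N]
    [Module A N] [AddCommGroup N'] [Module A N'] (f : N →ₗ[A] N')
    (hinj : ∀ x, f x = 0 → ∃ s ∈ S, s • x = 0) (hsurj : ∀ y, ∃ s ∈ S, ∃ x, f x = s • y) :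
    Function.Bijective (LocalizedModule.map S f) := by
  refine ⟨(injective_iff_map_eq_zero _).2 fun x hx => ?_, fun y => ?_⟩
  · induction x using LocalizedModule.induction_on with
    | h m s =>
      rw [LocalizedModule.map_mk, ← LocalizedModule.zero_mk 1, LocalizedModule.mk_eq] at hx
      obtain ⟨u, hu⟩ := hx
      have hu' : f ((u : A) • m) = 0 := by
        simpa [Submonoid.smul_def] using hu
      obtain ⟨t, ht, htm⟩ := hinj _ hu'
      rw [← LocalizedModule.zero_mk 1, LocalizedModule.mk_eq]
      refine ⟨⟨t, ht⟩ * u, ?_⟩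
      simpa [Submonoid.smul_def, mul_smul] using htm
  · induction y using LocalizedModule.induction_on with
    | h m s =>
      obtain ⟨t, ht, x, hx⟩ := hsurj m
      refine ⟨LocalizedModule.mk x (⟨t, ht⟩ * s), ?_⟩
      rw [LocalizedModule.map_mk, hx, LocalizedModule.mk_eq]
      exact ⟨1, by simp only [Submonoid.smul_def, one_smul, mul_smul, smul_comm t]⟩

end CommutativeAlgebra

/-! ### Separating group elements by functions -/

section Separation

variable (k : Type*) {G A : Type*} [Field k] [Group G] [CommRing A] [Algebra k A]
  [MulSemiringAction G A] [SMulCommClass G k A] [Finite G]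

open Polynomial in
/-- An element outside the inertia group `I` of a prime ideal `P` acts nontrivially modulo `P` on
the invariants of `I`. -/
theorem exists_mem_invariantRing_sub_smul_notMem (K : Subgroup G) (P : Ideal A) [P.IsPrime]
    {h : G} (hK : h ∈ K) (hI : h ∉ inertiaIn K P) :
    ∃ e : invariantRing k A (inertiaIn K P), (e : A) - h • (e : A) ∉ P := by
  classical
  have : Fintype (inertiaIn K P) := Fintype.ofFinite _
  obtain ⟨a, ha⟩ : ∃ a : A, h • a - a ∉ P := by
    by_contra! hcon
    exact hI (mem_inertiaIn.2 ⟨hK, hcon⟩)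
  by_contra! hcon
  let π := Ideal.Quotient.mk P
  let θ : A →+* A ⧸ P := π.comp (MulSemiringAction.toRingHom G A h)
  -- The coefficients of `∏ (X - g a)`, `g` in the inertia group, are invariants, so `h` would not
  -- move them modulo `P`. Modulo `P` the product is a power of `X - a`, while its `h`-twist has the
  -- root `h a`; hence `h a - a ∈ P`.
  have hmap : (MulSemiringAction.charpoly (inertiaIn K P) a).map π
      = (MulSemiringAction.charpoly (inertiaIn K P) a).map θ := by
    ext n
    rw [coeff_map, coeff_map]
    refine Ideal.Quotient.eq.2 (hcon ⟨_, fun g => ?_⟩)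
    exact MulSemiringAction.smul_coeff_charpoly a n g
  have hpow : (MulSemiringAction.charpoly (inertiaIn K P) a).map π
      = (X - C (π a)) ^ Fintype.card (inertiaIn K P) := by
    rw [MulSemiringAction.charpoly_eq, Polynomial.map_prod, ← Finset.card_univ,
      ← Finset.prod_const]
    refine Finset.prod_congr rfl fun g _ => ?_
    rw [Polynomial.map_sub, map_X, map_C]
    congr 2
    exact Ideal.Quotient.eq.2 (g.2.2 a)
  have heval : ((MulSemiringAction.charpoly (inertiaIn K P) a).map θ).eval (θ a) = 0 := by
    rw [eval_map_apply, MulSemiringAction.eval_charpoly, map_zero]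
  rw [← hmap, hpow, eval_pow, eval_sub, eval_X, eval_C] at heval
  exact ha (Ideal.Quotient.eq.1 (sub_eq_zero.1 (eq_zero_of_pow_eq_zero heval)))

/-- There is a finite family that separates the inertia group `I` of a prime ideal `P` from the
remaining elements of the group. -/
theorem exists_separating_family (K : Subgroup G) (P : Ideal A) [P.IsPrime] :
    ∃ S : Finset (invariantRing k A (inertiaIn K P) × A),
      (∀ h ∈ K, h ∉ inertiaIn K P → ∑ p ∈ S, (p.1 : A) * h • p.2 = 0) ∧
      ∑ p ∈ S, (p.1 : A) * p.2 ∉ P := by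
  classical
  have : Fintype G := Fintype.ofFinite _
  have hex : ∀ h : G, ∃ e : invariantRing k A (inertiaIn K P),
      h ∈ K → h ∉ inertiaIn K P → (e : A) - h⁻¹ • (e : A) ∉ P := fun h => by
    by_cases hh : h ∈ K ∧ h ∉ inertiaIn K P
    · obtain ⟨e, he⟩ := exists_mem_invariantRing_sub_smul_notMem k K P (K.inv_mem hh.1)
        (fun hi => hh.2 (by simpa using (inertiaIn K P).inv_mem hi))
      exact ⟨e, fun _ _ => he⟩
    · exact ⟨0, fun h1 h2 => absurd ⟨h1, h2⟩ hh⟩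
  choose e he using hex
  let μ : G → (invariantRing k A (inertiaIn K P) ⊗[k] A →ₐ[k] A) := fun h =>
    Algebra.TensorProduct.productMap (invariantRing k A (inertiaIn K P)).val
      (MulSemiringAction.toAlgHom k A h)
  -- `μ h` sends `e ⊗ a` to `e * h a`. It kills the factor indexed by `h`, whereas `μ 1` maps every
  -- factor outside `P`; the family consists of the terms of `x`.
  let x : invariantRing k A (inertiaIn K P) ⊗[k] A :=
    ∏ h ∈ Finset.univ.filter (fun h => h ∈ K ∧ h ∉ inertiaIn K P),
      (e h ⊗ₜ[k] 1 - 1 ⊗ₜ[k] (h⁻¹ • (e h : A)))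
  have hμ : ∀ g h : G, μ g (e h ⊗ₜ[k] 1 - 1 ⊗ₜ[k] (h⁻¹ • (e h : A)))
      = (e h : A) - g • h⁻¹ • (e h : A) := fun g h => by
    simp [μ]
  obtain ⟨S, hS⟩ := TensorProduct.exists_finset x
  have hμx : ∀ g, μ g x = ∑ p ∈ S, (p.1 : A) * g • p.2 := fun g => by
    rw [hS, map_sum]
    rfl
  refine ⟨S, fun h hK hI => ?_, ?_⟩
  · rw [← hμx, map_prod]
    refine Finset.prod_eq_zero (i := h) (by simp [hK, hI]) ?_
    rw [hμ, smul_inv_smul, sub_self]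
  · have h1 := hμx 1
    simp only [one_smul] at h1
    rw [← h1, map_prod]
    have hP : P.IsPrime := inferInstance
    rw [hP.prod_mem_iff]
    rintro ⟨h, hh, hm⟩
    rw [hμ, one_smul] at hm
    have hh' := (Finset.mem_filter.1 hh).2
    exact he h hh'.1 hh'.2 hm

theorem inertiaIn_bot {G A : Type*} [Group G] [CommRing A] [MulSemiringAction G A]
    [FaithfulSMul G A] (K : Subgroup G) : inertiaIn K (⊥ : Ideal A) = ⊥ := by
  refine (Subgroup.eq_bot_iff_forall _).2 fun g hg =>
    FaithfulSMul.eq_of_smul_eq_smul fun a : A => ?_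
  rw [one_smul]
  exact sub_eq_zero.1 ((Submodule.mem_bot A).1 (hg.2 a))

/-- A finite family that is dual to itself for the action of `G`, up to a nonzero invariant. -/
theorem exists_dual_family (k G A : Type*) [Field k] [Group G] [CommRing A] [Algebra k A]
    [MulSemiringAction G A] [SMulCommClass G k A] [Finite G] [IsDomain A] [FaithfulSMul G A] :
    ∃ (s : A) (S : Finset (A × A)), s ≠ 0 ∧ (∀ g : G, g • s = s) ∧ ∑ p ∈ S, p.1 * p.2 = s ∧
      (∀ g : G, g ≠ 1 → ∑ p ∈ S, p.1 * g • p.2 = 0) ∧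
      (∀ g : G, g ≠ 1 → ∑ p ∈ S, g • p.1 * p.2 = 0) := by
  classical
  have : Fintype G := Fintype.ofFinite _
  obtain ⟨S, hS0, hS⟩ := exists_separating_family k (⊤ : Subgroup G) (⊥ : Ideal A)
  rw [Submodule.mem_bot] at hS
  set s := ∑ p ∈ S, (p.1 : A) * p.2 with hs
  have hs0 : ∀ g : G, g • s ≠ 0 := fun g => (smul_ne_zero_iff_ne g).2 hS
  -- The sum `s` need not be invariant; scaling the first components by `n` replaces it by its norm.
  let n : A := ∏ g ∈ Finset.univ.erase (1 : G), g • s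
  have hn : n ≠ 0 := Finset.prod_ne_zero_iff.2 fun g _ => hs0 g
  have hns : n * s = ∏ g : G, g • s := by
    rw [← Finset.prod_erase_mul _ _ (Finset.mem_univ (1 : G)), one_smul]
  have hsum : ∀ f : A × A → A,
      ∑ p ∈ S.image (fun p => (n * (p.1 : A), p.2)), f p = ∑ p ∈ S, f (n * (p.1 : A), p.2) :=
    fun f => Finset.sum_image fun p _ q _ hpq => Prod.ext
      (Subtype.ext (mul_left_cancel₀ hn (Prod.mk.inj hpq).1)) (Prod.mk.inj hpq).2
  have hzero : ∀ g : G, g ≠ 1 →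
      ∑ p ∈ S.image (fun p => (n * (p.1 : A), p.2)), p.1 * g • p.2 = 0 := fun g hg => by
    rw [hsum]
    simp_rw [mul_assoc]
    rw [← Finset.mul_sum, hS0 g trivial (by rwa [inertiaIn_bot, Subgroup.mem_bot]), mul_zero]
  refine ⟨n * s, S.image (fun p => (n * (p.1 : A), p.2)), mul_ne_zero hn hS, fun g => ?_, ?_,
    hzero, fun g hg => ?_⟩
  · rw [hns, Finset.smul_prod']
    simp_rw [smul_smul]
    exact Equiv.prod_comp (Equiv.mulLeft g) fun h => h • s
  · rw [hsum]
    simp_rw [mul_assoc]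
    rw [← Finset.mul_sum]
  -- Applying `g` to the relation for `g⁻¹` moves the action to the other factor.
  · have h := congrArg (g • ·) (hzero g⁻¹ (by simpa using hg))
    simpa only [Finset.smul_sum, smul_mul', smul_inv_smul, smul_zero] using h

end Separation

/-! ### Traces and the modules `D_H` -/

section Trace

variable {k G A M : Type*} [Field k] [Group G] [CommRing A] [Algebra k A]
  [MulSemiringAction G A] [SMulCommClass G k A]
  [AddCommGroup M] [Module k M] (ρ : Representation k G M)

theorem mem_covariants_of_smul_mem [IsDomain A] {s : A} (hs0 : s ≠ 0) (hs : ∀ g : G, g • s = s)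
    {H : Subgroup G} {v : A ⊗[k] M} (hv : s • v ∈ covariants A ρ H) : v ∈ covariants A ρ H :=
  fun h hh => smul_right_injective _ hs0 <| by
    have := hv h hh
    rwa [diagAction_smul, hs] at this

variable [Finite G]

/-- The sum of the elements of a finite group `H` acting on `A ⊗ M`. -/
noncomputable def traceMap (H : Subgroup G) : A ⊗[k] M →ₗ[k] A ⊗[k] M :=
  letI := Fintype.ofFinite H
  ∑ h : H, diagAction ρ (h : G)

theorem traceMap_apply (H : Subgroup G) [Fintype H] (w : A ⊗[k] M) :
    traceMap ρ H w = ∑ h : H, diagAction ρ (h : G) w := by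
  rw [traceMap, LinearMap.sum_apply]
  exact Finset.sum_congr (by ext; simp) fun _ _ => rfl

open Classical in
theorem traceMap_apply_eq_sum_ite [Fintype G] (H : Subgroup G) (w : A ⊗[k] M) :
    traceMap ρ H w = ∑ g : G, if g ∈ H then diagAction ρ g w else 0 := by
  rw [traceMap_apply, ← Finset.sum_filter]
  exact (Finset.sum_subtype _ (fun g => by simp) fun g => diagAction ρ g w).symm

theorem traceMap_mem (H : Subgroup G) (w : A ⊗[k] M) : traceMap ρ H w ∈ covariants A ρ H := by
  intro h hh
  have : Fintype H := Fintype.ofFinite _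
  rw [traceMap_apply, map_sum]
  simp_rw [← Module.End.mul_apply, ← map_mul]
  exact Equiv.sum_comp (Equiv.mulLeft (⟨h, hh⟩ : H)) fun g : H => diagAction ρ (g : G) w

theorem traceMap_smul {H : Subgroup G} {c : A} (hc : c ∈ invariantRing k A H) (w : A ⊗[k] M) :
    traceMap ρ H (c • w) = c • traceMap ρ H w := by
  have : Fintype H := Fintype.ofFinite _
  rw [traceMap_apply, traceMap_apply, Finset.smul_sum]
  refine Finset.sum_congr rfl fun h _ => ?_
  rw [diagAction_smul, mem_invariantRing.1 hc h h.2]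

/-- Transitivity of the trace: sort the elements of `K` by their left cosets of `H`. -/
theorem transfer_traceMap {H K : Subgroup G} (hHK : H ≤ K) (w : A ⊗[k] M) :
    (transfer A ρ H K ⟨traceMap ρ H w, traceMap_mem ρ H w⟩ : A ⊗[k] M) = traceMap ρ K w := by
  classical
  have : Fintype H := Fintype.ofFinite _
  have : Fintype K := Fintype.ofFinite _
  have : Fintype (K ⧸ H.subgroupOf K) := Fintype.ofFinite _
  rw [transfer_coe, finsum_eq_sum_of_fintype, traceMap_apply ρ K,
    ← Finset.sum_fiberwise Finset.univ (fun g : K => (g : K ⧸ H.subgroupOf K))]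
  refine Finset.sum_congr rfl fun q _ => ?_
  induction q using QuotientGroup.induction_on with
  | H τ =>
    rw [cosetAction_mk]
    change diagAction ρ (τ : G) (traceMap ρ H w) = _
    rw [traceMap_apply, map_sum]
    refine Finset.sum_bij (fun h _ => τ * ⟨h, hHK h.2⟩) (fun h _ => ?_) (fun h _ h' _ e => ?_)
      (fun g hg => ?_) (fun h _ => ?_)
    · refine Finset.mem_filter.2 ⟨Finset.mem_univ _, (QuotientGroup.eq.2 ?_).symm⟩
      simp [Subgroup.mem_subgroupOf]
    · exact Subtype.ext (congrArg (fun g : K => (g : G)) (mul_left_cancel (a := τ) e))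
    · have := QuotientGroup.eq.1 (Finset.mem_filter.1 hg).2.symm
      exact ⟨⟨(τ⁻¹ * g : K), this⟩, Finset.mem_univ _, Subtype.ext (by simp)⟩
    · rw [← Module.End.mul_apply, ← map_mul]
      rfl

variable (A) in
/-- The elements `w` such that all the traces of the multiples of `w` are divisible by `s`. -/
def traceDual (s : A) (H : Subgroup G) : Submodule A (A ⊗[k] M) where
  carrier := {w | ∀ b : A, ∃ v, traceMap ρ H (b • w) = s • v}
  add_mem' {w w'} hw hw' b := by
    obtain ⟨v, hv⟩ := hw b
    obtain ⟨v', hv'⟩ := hw' b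
    exact ⟨v + v', by rw [smul_add, map_add, hv, hv', smul_add]⟩
  zero_mem' b := ⟨0, by simp⟩
  smul_mem' a w hw b := by
    rw [smul_smul]
    exact hw (b * a)

theorem smul_mem_traceDual {s : A} (hs : ∀ g : G, g • s = s) (H : Subgroup G) (w : A ⊗[k] M) :
    s • w ∈ traceDual A ρ s H := fun b =>
  ⟨traceMap ρ H (b • w), by
    rw [smul_comm, traceMap_smul ρ (mem_invariantRing.2 fun g _ => hs g)]⟩

/-- The quotient of `Tr_H(b w)` by `s` is again `H`-invariant, so it can be transferred to `K`; the
transfer commutes with `s`. -/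
theorem traceDual_mono [IsDomain A] {s : A} (hs0 : s ≠ 0) (hs : ∀ g : G, g • s = s)
    {H K : Subgroup G} (hHK : H ≤ K) : traceDual A ρ s H ≤ traceDual A ρ s K := fun w hw b => by
  obtain ⟨v, hv⟩ := hw b
  have hvH : v ∈ covariants A ρ H := mem_covariants_of_smul_mem ρ hs0 hs (hv ▸ traceMap_mem ρ H _)
  refine ⟨transfer A ρ H K ⟨v, hvH⟩, ?_⟩
  rw [← transfer_traceMap ρ hHK]
  have h := transfer_smul ρ hHK ⟨s, mem_invariantRing.2 fun g _ => hs g⟩ ⟨v, hvH⟩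
  refine Eq.trans ?_ (congrArg Subtype.val h)
  congr 2
  exact Subtype.ext hv

/-- Locally at a prime ideal, `traceDual` depends only on the inertia group. -/
theorem exists_smul_mem_traceDual_inertiaIn (s : A) (K : Subgroup G) (P : Ideal A) [P.IsPrime] :
    ∃ t ∉ P, ∀ w ∈ traceDual A ρ s K, t • w ∈ traceDual A ρ s (inertiaIn K P) := by
  classical
  have : Fintype G := Fintype.ofFinite _
  obtain ⟨S, hS0, hS⟩ := exists_separating_family k K P
  refine ⟨_, hS, fun w hw b => ?_⟩
  choose v hv using hw
  -- With `I` the inertia group and `t = ∑ p.1 * p.2`, the point is `Tr_I(b t w) = ∑ p.1 Tr_K(p.2 b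
  -- w)`: elements outside `I` cancel by separation, and those in `I` fix `p.1`.
  refine ⟨∑ p ∈ S, (p.1 : A) • v (p.2 * b), ?_⟩
  rw [Finset.smul_sum]
  simp_rw [smul_comm s, ← hv, traceMap_apply_eq_sum_ite, Finset.smul_sum]
  rw [Finset.sum_comm]
  refine Finset.sum_congr rfl fun g _ => ?_
  by_cases hK : g ∈ K
  · have h1 : ∀ p : invariantRing k A (inertiaIn K P) × A,
        (p.1 : A) • diagAction ρ g ((p.2 * b) • w)
          = ((p.1 : A) * g • p.2) • diagAction ρ g (b • w) := fun p => by
      rw [mul_smul p.2, diagAction_smul, smul_smul]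
    simp_rw [if_pos hK, h1, ← Finset.sum_smul]
    by_cases hI : g ∈ inertiaIn K P
    · rw [if_pos hI, smul_smul, mul_comm, mul_smul, diagAction_smul, Finset.smul_sum]
      congr 1
      refine Finset.sum_congr rfl fun p _ => ?_
      rw [smul_mul', mem_invariantRing.1 p.1.2 g hI]
    · rw [if_neg hI, hS0 g hK hI, zero_smul]
  · have hI : g ∉ inertiaIn K P := fun hI => hK hI.1
    simp [hK, hI]

end Trace

/-! ### Embedding the Hom modules into `A ⊗ M` -/

section Embedding

variable {k G A M : Type*} [Field k] [Group G] [CommRing A] [Algebra k A]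
  [MulSemiringAction G A] [SMulCommClass G k A]
  [AddCommGroup M] [Module k M] (ρ : Representation k G M)

theorem coe_homCov_mul {H : Subgroup G} (φ : HomCov A ρ H) {c : A}
    (hc : c ∈ invariantRing k A H) (b : A) :
    (φ (c * b) : A ⊗[k] M) = c • (φ b : A ⊗[k] M) :=
  congrArg Subtype.val (map_smul φ (⟨c, hc⟩ : invariantRing k A H) b)

theorem sum_smul_mem_invariantRing (H : Subgroup G) [Fintype H] (c : A) :
    ∑ h : H, (h : G) • c ∈ invariantRing k A H := by
  refine mem_invariantRing.2 fun h hh => ?_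
  rw [Finset.smul_sum]
  simp_rw [smul_smul]
  exact Equiv.sum_comp (Equiv.mulLeft (⟨h, hh⟩ : H)) fun g : H => (g : G) • c

variable [Finite G]

/-- The trace form is nondegenerate. -/
theorem eq_of_traceMap_smul_eq [IsDomain A] [FaithfulSMul G A] {H : Subgroup G}
    {w w' : A ⊗[k] M} (h : ∀ b : A, traceMap ρ H (b • w) = traceMap ρ H (b • w')) : w = w' := by
  classical
  have : Fintype H := Fintype.ofFinite _
  obtain ⟨s, S, hs0, -, hs, hS, -⟩ := exists_dual_family k G A
  -- The dual family recovers `s w` from the traces: only the identity survives in the double sum.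
  have key : ∀ w : A ⊗[k] M, ∑ p ∈ S, p.1 • traceMap ρ H (p.2 • w) = s • w := fun w => by
    simp_rw [traceMap_apply, diagAction_smul, Finset.smul_sum, smul_smul]
    rw [Finset.sum_comm, Finset.sum_eq_single (1 : H)]
    · simp [← Finset.sum_smul, hs]
    · intro g _ hg
      rw [← Finset.sum_smul, hS g fun h1 => hg (Subtype.ext h1), zero_smul]
    · exact fun h1 => absurd (Finset.mem_univ _) h1
  refine smul_right_injective _ hs0 ?_
  change s • w = s • w'
  rw [← key, ← key]
  simp_rw [h]

/-- Invariance of `φ p.2` and linearity of `φ` give `Tr(b p.1 φ(p.2)) = φ(Tr(b p.1) p.2)`, and `∑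
Tr(b p.1) p.2 = s b` by duality. Thus `∑ p.1 φ(p.2)` is the element representing `s φ` under the
trace form. -/
theorem traceMap_sum_smul_homCov {s : A} {S : Finset (A × A)} (hs : ∀ g : G, g • s = s)
    (hS : ∑ p ∈ S, p.1 * p.2 = s)
    (hS' : ∀ g : G, g ≠ 1 → ∑ p ∈ S, g • p.1 * p.2 = 0) {H : Subgroup G}
    (φ : HomCov A ρ H) (b : A) :
    traceMap ρ H (b • ∑ p ∈ S, p.1 • (φ p.2 : A ⊗[k] M)) = s • (φ b : A ⊗[k] M) := by
  classical
  have : Fintype H := Fintype.ofFinite _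
  have h1 : ∀ p : A × A, traceMap ρ H (b • p.1 • (φ p.2 : A ⊗[k] M))
      = φ ((∑ h : H, (h : G) • (b * p.1)) * p.2) := fun p => by
    rw [coe_homCov_mul ρ φ (sum_smul_mem_invariantRing H _), traceMap_apply, Finset.sum_smul]
    refine Finset.sum_congr rfl fun h _ => ?_
    rw [smul_smul, diagAction_smul, (φ p.2).2 h h.2]
  have h2 : ∑ p ∈ S, (∑ h : H, (h : G) • (b * p.1)) * p.2 = s * b := by
    simp_rw [Finset.sum_mul, smul_mul', mul_assoc]
    rw [Finset.sum_comm]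
    simp_rw [← Finset.mul_sum]
    rw [Finset.sum_eq_single (1 : H)]
    · simp [hS, mul_comm]
    · intro g _ hg
      rw [hS' g fun h1 => hg (Subtype.ext h1), mul_zero]
    · exact fun h1 => absurd (Finset.mem_univ _) h1
  rw [← coe_homCov_mul ρ φ (mem_invariantRing.2 fun g _ => hs g), ← h2, Finset.smul_sum, map_sum,
    map_sum, AddSubmonoidClass.coe_finsetSum]
  exact Finset.sum_congr rfl fun p _ => h1 p

theorem exists_homCov_of_mem_traceDual [IsDomain A] {s : A} (hs0 : s ≠ 0)
    (hs : ∀ g : G, g • s = s) {H : Subgroup G} {w : A ⊗[k] M} (hw : w ∈ traceDual A ρ s H) :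
    ∃ φ : HomCov A ρ H, ∀ b : A, traceMap ρ H (b • w) = s • (φ b : A ⊗[k] M) := by
  choose v hv using hw
  have hinj : Function.Injective fun x : A ⊗[k] M => s • x := smul_right_injective _ hs0
  have hmem : ∀ b, v b ∈ covariants A ρ H := fun b =>
    mem_covariants_of_smul_mem ρ hs0 hs (hv b ▸ traceMap_mem ρ H _)
  refine ⟨HomCov.ofLinearMap
    { toFun := fun b => ⟨v b, hmem b⟩
      map_add' := fun b c => Subtype.ext (hinj ?_)
      map_smul' := fun c b => Subtype.ext (hinj ?_) }, hv⟩
  · change s • v (b + c) = s • (v b + v c)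
    rw [← hv, add_smul, map_add, hv, hv, smul_add]
  · change s • v ((c : A) * b) = s • (c : A) • v b
    rw [← hv, mul_smul, traceMap_smul ρ c.2, hv, smul_comm]

variable (A) in
/-- The modules `Hom_{A^H}(A, (A ⊗ M)^H)` embed compatibly into `A ⊗ M`. -/
theorem exists_embedding [IsDomain A] [FaithfulSMul G A] :
    ∃ (s : A) (ι : ∀ H : Subgroup G, HomCov A ρ H →ₗ[A] A ⊗[k] M),
      s ≠ 0 ∧ (∀ g : G, g • s = s) ∧ (∀ H, Function.Injective (ι H)) ∧
      (∀ H, LinearMap.range (ι H) = traceDual A ρ s H) ∧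
      ∀ (H K : Subgroup G) (hHK : H ≤ K) (φ : HomCov A ρ H), ι K (Phi A ρ hHK φ) = ι H φ := by
  obtain ⟨s, S, hs0, hs, hS, -, hS'⟩ := exists_dual_family k G A
  have key := fun (H : Subgroup G) (φ : HomCov A ρ H) => traceMap_sum_smul_homCov ρ hs hS hS' φ
  have hinj : Function.Injective fun x : A ⊗[k] M => s • x := smul_right_injective _ hs0
  let ι : ∀ H : Subgroup G, HomCov A ρ H →ₗ[A] A ⊗[k] M := fun H =>
    { toFun := fun φ => ∑ p ∈ S, p.1 • (φ p.2 : A ⊗[k] M)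
      map_add' := fun φ ψ => by
        rw [← Finset.sum_add_distrib]
        refine Finset.sum_congr rfl fun p _ => ?_
        rw [← smul_add]
        rfl
      -- The formula for `ι` is not visibly `A`-linear; linearity follows because both sides have
      -- the same traces.
      map_smul' := fun a φ => eq_of_traceMap_smul_eq (H := H) ρ fun b => by
        rw [key, RingHom.id_apply, smul_smul, key, homCov_smul_apply, mul_comm] }
  have hι : ∀ (H : Subgroup G) (φ : HomCov A ρ H) (b : A),
      traceMap ρ H (b • ι H φ) = s • (φ b : A ⊗[k] M) := key
  refine ⟨s, ι, hs0, hs, fun H φ ψ h => ?_, fun H => le_antisymm ?_ fun w hw => ?_,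
    fun H K hHK φ => ?_⟩
  · refine DFunLike.ext _ _ fun b => Subtype.ext (hinj ?_)
    change s • (φ b : A ⊗[k] M) = s • (ψ b : A ⊗[k] M)
    rw [← hι, ← hι, h]
  · rintro _ ⟨φ, rfl⟩ b
    exact ⟨φ b, hι H φ b⟩
  · obtain ⟨φ, hφ⟩ := exists_homCov_of_mem_traceDual ρ hs0 hs hw
    exact ⟨φ, eq_of_traceMap_smul_eq (H := H) ρ fun b => by rw [hι, hφ]⟩
  · refine eq_of_traceMap_smul_eq (H := K) ρ fun b => ?_
    rw [hι, Phi_apply, ← transfer_traceMap ρ hHK]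
    have h := transfer_smul ρ hHK ⟨s, mem_invariantRing.2 fun g _ => hs g⟩ (φ b)
    refine (congrArg Subtype.val h).symm.trans ?_
    congr 2
    exact Subtype.ext (hι H φ b).symm

end Embedding

/-! ### Local comparison and the three assertions -/

section Main

variable {k G A M : Type*} [Field k] [Group G] [CommRing A] [Algebra k A]
  [MulSemiringAction G A] [SMulCommClass G k A]
  [AddCommGroup M] [Module k M] (ρ : Representation k G M) [Finite G] [IsDomain A]

/-- Membership in `traceDual` can be checked locally at the prime ideals of height one. -/
theorem mem_traceDual_of_forall_height_eq_one [IsNoetherianRing A] [IsIntegrallyClosed A]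
    [FiniteDimensional k M] {s : A} (hs0 : s ≠ 0) (H : Subgroup G) (u : A ⊗[k] M)
    (hu : ∀ P : Ideal A, P.IsPrime → P.height = 1 → ∃ t ∉ P, t • u ∈ traceDual A ρ s H) :
    u ∈ traceDual A ρ s H := by
  classical
  have : Fintype H := Fintype.ofFinite _
  refine fun b => exists_smul_eq_of_forall_height_eq_one (F := A ⊗[k] M) hs0 fun P hP h1 => ?_
  let J : Ideal A := (traceDual A ρ s H).comap (LinearMap.toSpanSingleton A _ u)
  have hJ : ∀ a, a ∈ J ↔ a • u ∈ traceDual A ρ s H := fun a => Iff.rfl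
  let f : H → Ideal A := fun h => P.comap (MulSemiringAction.toRingEquiv G A (h : G))
  have hf : ∀ h, (f h).IsPrime := fun h => Ideal.comap_isPrime _ _
  -- The trace is only `A^H`-linear, so an `H`-invariant denominator is needed. All `H`-conjugates
  -- of `P` have height one; prime avoidance gives one `a ∈ J` outside all of them, and its norm is
  -- an invariant outside `P`.
  obtain ⟨a, haJ, ha⟩ : ∃ a ∈ J, ∀ h, a ∉ f h := by
    by_contra! hcon
    have hsub : (J : Set A) ⊆ ⋃ h ∈ ((Finset.univ : Finset H) : Set H), f h := fun a ha => by
      obtain ⟨h, hh⟩ := hcon a ha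
      exact Set.mem_biUnion (Finset.mem_coe.2 (Finset.mem_univ h)) hh
    obtain ⟨h, -, hle⟩ := (Ideal.subset_union_prime 1 1 fun h _ _ _ => hf h).1 hsub
    obtain ⟨t, ht, htu⟩ := hu (f h) (hf h) ((RingEquiv.height_comap _ P).trans h1)
    exact ht (hle ((hJ t).2 htu))
  let t : A := ∏ h : H, (h : G) • a
  have htP : t ∉ P := fun ht => by
    obtain ⟨h, -, hh⟩ := hP.prod_mem_iff.1 ht
    exact ha h hh
  have htJ : t ∈ J := by
    have : t = (∏ h ∈ Finset.univ.erase (1 : H), (h : G) • a) * a := by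
      change ∏ h : H, (h : G) • a = _
      rw [← Finset.prod_erase_mul _ _ (Finset.mem_univ (1 : H)), Subgroup.coe_one, one_smul]
    rw [this]
    exact J.mul_mem_left _ haJ
  have htH : t ∈ invariantRing k A H := mem_invariantRing.2 fun h hh => by
    rw [Finset.smul_prod']
    simp_rw [smul_smul]
    exact Equiv.prod_comp (Equiv.mulLeft (⟨h, hh⟩ : H)) fun g : H => (g : G) • a
  obtain ⟨v, hv⟩ := (hJ t).1 htJ b
  exact ⟨t, htP, v, by rw [← hv, smul_comm b, traceMap_smul ρ htH]⟩

variable [FaithfulSMul G A]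

theorem finite_and_isReflexive_homCov [IsNoetherianRing A] [IsIntegrallyClosed A]
    [FiniteDimensional k M] (H : Subgroup G) :
    Module.Finite A (HomCov A ρ H) ∧ Module.IsReflexive A (HomCov A ρ H) := by
  obtain ⟨s, ι, hs0, hs, hinj, hrange, -⟩ := exists_embedding A ρ
  let e : HomCov A ρ H ≃ₗ[A] traceDual A ρ s H :=
    (LinearEquiv.ofInjective (ι H) (hinj H)).trans (LinearEquiv.ofEq _ _ (hrange H))
  have := isReflexive_of_forall_height_eq_one (traceDual A ρ s H) hs0
    (smul_mem_traceDual ρ hs H) (mem_traceDual_of_forall_height_eq_one ρ hs0 H)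
  exact ⟨Module.Finite.equiv e.symm, Module.equiv e.symm⟩

theorem Phi_injective {H K : Subgroup G} (hHK : H ≤ K) : Function.Injective (Phi A ρ hHK) := by
  obtain ⟨s, ι, -, -, hinj, -, hΦ⟩ := exists_embedding A ρ
  intro φ ψ h
  refine hinj H ?_
  rw [← hΦ H K hHK, h, hΦ]

/-- The image of `Φ^K_H` is described by membership in `traceDual`. -/
theorem exists_mem_traceDual_iff :
    ∃ s : A, s ≠ 0 ∧ (∀ g : G, g • s = s) ∧ ∀ K : Subgroup G,
      ∃ ι : HomCov A ρ K →ₗ[A] A ⊗[k] M, ∀ (H : Subgroup G) (hHK : H ≤ K) (ψ : HomCov A ρ K),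
        ψ ∈ LinearMap.range (Phi A ρ hHK) ↔ ι ψ ∈ traceDual A ρ s H := by
  obtain ⟨s, ι, hs0, hs, hinj, hrange, hΦ⟩ := exists_embedding A ρ
  refine ⟨s, hs0, hs, fun K => ⟨ι K, fun H hHK ψ => ⟨?_, fun h => ?_⟩⟩⟩
  · rintro ⟨φ, rfl⟩
    rw [hΦ, ← hrange]
    exact ⟨φ, rfl⟩
  · rw [← hrange] at h
    obtain ⟨φ, hφ⟩ := h
    exact ⟨φ, hinj K (by rw [hΦ, hφ])⟩

/-- The elements of the image of `Φ^K_L` come, locally at `P`, from every subgroup that contains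
the inertia group of `P` in `L`. -/
theorem exists_smul_mem_range_Phi {K L : Subgroup G} (hLK : L ≤ K) (P : Ideal A) [P.IsPrime]
    {ψ : HomCov A ρ K} (hψ : ψ ∈ LinearMap.range (Phi A ρ hLK)) {H : Subgroup G} (hHK : H ≤ K)
    (hH : inertiaIn L P ≤ H) : ∃ t ∉ P, t • ψ ∈ LinearMap.range (Phi A ρ hHK) := by
  obtain ⟨s, hs0, hs, hι⟩ := exists_mem_traceDual_iff (A := A) ρ
  obtain ⟨ι, hι⟩ := hι K
  obtain ⟨t, ht, h⟩ := exists_smul_mem_traceDual_inertiaIn ρ s L P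
  refine ⟨t, ht, (hι H hHK _).2 ?_⟩
  rw [map_smul]
  exact traceDual_mono ρ hs0 hs hH (h _ ((hι L hLK ψ).1 hψ))

theorem Phi_comp {H K L : Subgroup G} (hHK : H ≤ K) (hKL : K ≤ L) (φ : HomCov A ρ H) :
    Phi A ρ hKL (Phi A ρ hHK φ) = Phi A ρ (hHK.trans hKL) φ := by
  obtain ⟨s, ι, -, -, hinj, -, hΦ⟩ := exists_embedding A ρ
  exact hinj L (by rw [hΦ, hΦ, hΦ])

/-- `Φ^K_K` is the identity, so the statements about images apply to every `ψ`. -/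
theorem mem_range_Phi_self (K : Subgroup G) (ψ : HomCov A ρ K) :
    ψ ∈ LinearMap.range (Phi A ρ (le_refl K)) := by
  obtain ⟨s, ι, -, -, hinj, -, hΦ⟩ := exists_embedding A ρ
  exact ⟨ψ, hinj K (hΦ _ _ _ _)⟩

theorem isIsoAt_Phi {H K : Subgroup G} (hHK : H ≤ K) (P : Ideal A) [P.IsPrime]
    (hP : inertiaIn K P ≤ H) : IsIsoAt P (Phi A ρ hHK) :=
  localizedModule_map_bijective _ _
    (fun φ hφ => ⟨1, one_mem _, by
      rw [one_smul, Phi_injective ρ hHK (hφ.trans (map_zero _).symm)]⟩)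
    fun ψ => by
      obtain ⟨t, ht, φ, hφ⟩ :=
        exists_smul_mem_range_Phi ρ le_rfl P (mem_range_Phi_self ρ K ψ) hHK hP
      exact ⟨t, ht, φ, hφ⟩

theorem Phi_bijective_of_forall_inertiaIn_le [IsNoetherianRing A] [IsIntegrallyClosed A]
    [FiniteDimensional k M] {H K : Subgroup G} (hHK : H ≤ K)
    (h : ∀ P : Ideal A, P.IsPrime → P.height = 1 → inertiaIn K P ≤ H) :
    Function.Bijective (Phi A ρ hHK) := by
  refine ⟨Phi_injective ρ hHK, fun ψ => ?_⟩
  obtain ⟨s, hs0, hs, hι⟩ := exists_mem_traceDual_iff (A := A) ρ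
  obtain ⟨ι, hι⟩ := hι K
  refine (hι H hHK ψ).2 (mem_traceDual_of_forall_height_eq_one ρ hs0 H _ fun P hP h1 => ?_)
  obtain ⟨t, ht, hm⟩ := exists_smul_mem_range_Phi ρ le_rfl P (mem_range_Phi_self ρ K ψ) hHK
    (h P hP h1)
  exact ⟨t, ht, by rw [← map_smul]; exact (hι H hHK _).1 hm⟩

/-- The map of cokernels `C^L_J → C^K_H` induced by `Φ^K_L`. -/
noncomputable def cokerMap {J H L K : Subgroup G} (hJL : J ≤ L) (hHK : H ≤ K) (hJH : J ≤ H)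
    (hLK : L ≤ K) : Coker A ρ hJL →ₗ[A] Coker A ρ hHK :=
  Submodule.mapQ _ _ (Phi A ρ hLK) <| by
    rintro _ ⟨φ, rfl⟩
    exact ⟨Phi A ρ hJH φ, by rw [Phi_comp, Phi_comp]⟩

/-- This is the natural map from `D_{K_i} / D_{H_i}` to `D_K / D_H`; at `P` numerators and
denominators agree separately. Agreement of the denominators gives injectivity, that of the
numerators surjectivity. -/
theorem localizedModule_map_cokerMap_bijective {H K : Subgroup G} (hHK : H ≤ K) (P : Ideal A)
    [P.IsPrime] :
    Function.Bijective (LocalizedModule.map P.primeCompl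
      (cokerMap ρ (inertiaIn_mono hHK P) hHK (inf_le_left : inertiaIn H P ≤ H)
        (inf_le_left : inertiaIn K P ≤ K))) := by
  have hIK : inertiaIn K P ≤ K := inf_le_left
  refine localizedModule_map_bijective _ _ (fun x hx => ?_) fun y => ?_
  · obtain ⟨ψ, rfl⟩ := Submodule.Quotient.mk_surjective _ x
    have hψ : Phi A ρ hIK ψ ∈ LinearMap.range (Phi A ρ hHK) :=
      (Submodule.Quotient.mk_eq_zero _).1 hx
    obtain ⟨t, ht, φ, hφ⟩ := exists_smul_mem_range_Phi ρ hHK P hψ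
      ((inertiaIn_mono hHK P).trans hIK) le_rfl
    refine ⟨t, ht, (Submodule.Quotient.mk_eq_zero _).2 ⟨φ, Phi_injective ρ hIK ?_⟩⟩
    rw [Phi_comp, hφ, map_smul]
  · obtain ⟨ψ, rfl⟩ := Submodule.Quotient.mk_surjective _ y
    obtain ⟨t, ht, φ, hφ⟩ :=
      exists_smul_mem_range_Phi ρ le_rfl P (mem_range_Phi_self ρ K ψ) hIK le_rfl
    refine ⟨t, ht, Submodule.Quotient.mk φ, ?_⟩
    rw [← Submodule.Quotient.mk_smul, ← hφ]
    rfl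

end Main

end Covariants

open Covariants in
theorem mainTheorem5 {k G A M : Type*} [Field k] [Group G] [Finite G]
    [CommRing A] [IsDomain A] [Algebra k A] [Algebra.FiniteType k A] [IsIntegrallyClosed A]
    (𝒜 : ℕ → Submodule k A) [GradedAlgebra 𝒜] (h𝒜 : 𝒜 0 = 1)
    [MulSemiringAction G A] [SMulCommClass G k A] [FaithfulSMul G A]
    [AddCommGroup M] [Module k M] [FiniteDimensional k M] (ρ : Representation k G M)
    (H : Subgroup G) :
    ((Module.Finite A (HomCov A ρ H) ∧ Module.IsReflexive A (HomCov A ρ H)) ∧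
      (Module.Finite A (HomCov A ρ (⊤ : Subgroup G)) ∧
        Module.IsReflexive A (HomCov A ρ (⊤ : Subgroup G))) ∧
      Function.Injective (Phi A ρ (le_top : H ≤ ⊤)) ∧
      IsIsoAt (⊥ : Ideal A) (Phi A ρ (le_top : H ≤ ⊤)) ∧
      ∀ (P : Ideal A) [P.IsPrime], P.height = 1 → inertiaIn ⊤ P = inertiaIn H P →
        IsIsoAt P (Phi A ρ (le_top : H ≤ ⊤))) ∧
    (∀ K : Subgroup G, reflectionSubgroup G A ≤ K →
      Function.Bijective (Phi A ρ (le_top : K ≤ ⊤))) ∧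
    (∀ (P : Ideal A) [P.IsPrime], P.height = 1 →
      Nonempty
        (LocalizedModule P.primeCompl (Coker A ρ (le_top : H ≤ ⊤))
          ≃ₗ[Localization.AtPrime P]
        LocalizedModule P.primeCompl (Coker A ρ (inertiaIn_mono (le_top : H ≤ ⊤) P))) ∧
      Module.length (Localization.AtPrime P)
          (LocalizedModule P.primeCompl (Coker A ρ (le_top : H ≤ ⊤))) =
        Module.length (Localization.AtPrime P)
          (LocalizedModule P.primeCompl
            (Coker A ρ (inertiaIn_mono (le_top : H ≤ ⊤) P)))) := by
  have : IsNoetherianRing A := Algebra.FiniteType.isNoetherianRing k A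
  have equiv (P : Ideal A) [P.IsPrime] :
      LocalizedModule P.primeCompl (Coker A ρ (inertiaIn_mono (le_top : H ≤ ⊤) P))
        ≃ₗ[Localization.AtPrime P]
      LocalizedModule P.primeCompl (Coker A ρ (le_top : H ≤ ⊤)) :=
    LinearEquiv.ofBijective _ (localizedModule_map_cokerMap_bijective ρ (le_top : H ≤ ⊤) P)
  refine ⟨⟨finite_and_isReflexive_homCov ρ H, finite_and_isReflexive_homCov ρ ⊤,
    Phi_injective ρ le_top, isIsoAt_Phi ρ le_top ⊥ ?_, fun P _ _ hP => isIsoAt_Phi ρ le_top P ?_⟩,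
    fun K hK => Phi_bijective_of_forall_inertiaIn_le ρ le_top fun P hP h1 σ hσ => ?_,
    fun P _ _ => ⟨⟨(equiv P).symm⟩, (equiv P).symm.length_eq⟩⟩
  -- At the zero ideal inertia is trivial because the action is faithful.
  · rw [inertiaIn_bot]
    exact bot_le
  · rw [hP]
    exact inf_le_left
  · exact hK (Subgroup.subset_closure ⟨P, hP, h1, hσ⟩)
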